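/- **Model.** Let $M\ge 1$. The input is a finite sequence $I$ over an arbitrary linearly ordered set, presented one element at a time. A buffer holds the elements that have been read and not yet written; it has $M$ slots. An algorithm repeatedly reads the next input element into a free slot of the buffer, or ejects a buffered element and appends it to the output $S$, until all of $I$ has been written. A *run* is a sorted or reverse-sorted sequence; $R(S)$ is the least number of runs whose concatenation is $S$; and $\mathrm{OPT}(I)$ is the minimum of $R(S)$ over all output sequences $S$ that are possible on input $I$ with a buffer of size $M$ (by an offline algorithm). A *maximal increasing run* starts with the smallest element in the (full) buffer, always continues with the smallest buffered element that is at least as large as the last element written, each freed slot being refilled with the next input element as long as there is one, and ends only when no buffered element can continue it; maximal decreasing runs are defined symmetrically. A *proper* algorithm writes only maximal runs, choosing a direction at the start of each of them. The input $I$ is *3-nearly-sorted* if some proper algorithm on $I$ writes runs, all of length at least $3M$, whose concatenation $S$ satisfies $R(S)=\mathrm{OPT}(I)$. A *randomized online algorithm* using $M$ space in addition to its buffer of size $M$ chooses each action at random, depending only on the contents of its memory (it can access neither the remaining input nor the output already written). Its memory consists of the buffer; scratch space, which holds copies of elements that were in memory before, where at all times buffer and scratch space together hold at most $2M+O(1)$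 elements, of which at most $M$ have been read and not yet written; and $O(1)$ additional words of internal state, each taking $M+2$ values. The $O(1)$ terms are bounded by an absolute constant. **Theorem.** For every $M\ge 1$ there is a randomized online algorithm $A$ using $M$ space in addition to its buffer of size $M$, which on every input obeys these memory bounds and writes the whole input after a bounded number of actions (a bound that may depend on the input, but not on the random choices), such that for every 3-nearly-sorted input $I$ without duplicates the output $S$ of $A$ satisfies $$\mathbb E[R(S)]\le \tfrac32\,\mathrm{OPT}(I),$$ and, regardless of the random choices of $A$, $R(S)\le 2\,\mathrm{OPT}(I)$. -/

import Mathlib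

open scoped ENNReal

namespace RunGen

/-! ## Runs, and the number of runs of an output sequence -/

/-- A run: a sorted or reverse-sorted sequence. -/
def IsRun {α : Type*} [LinearOrder α] (l : List α) : Prop :=
  l.Pairwise (fun a b => a ≤ b) ∨ l.Pairwise (fun a b => b ≤ a)

/-- `R(S)`: the smallest number of runs whose concatenation is `S`. -/
noncomputable def numRuns {α : Type*} [LinearOrder α] (S : List α) : ℕ :=
  sInf {n | ∃ parts : List (List α),
    parts.length = n ∧ parts.flatten = S ∧ ∀ r ∈ parts, IsRun r}

/-! ## Possible outputs and the offline optimum -/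

/-- `Produces M buf inp S`: with buffer size `M`, current buffer contents `buf` (in arrival order)
and remaining input `inp`, it is possible to write exactly the sequence `S`, by reading the next
input element into a free buffer slot, and ejecting buffered elements to the output. -/
inductive Produces {α : Type*} (M : ℕ) : List α → List α → List α → Prop
  | done : Produces M [] [] []
  | read {buf inp S : List α} {x : α} :
      buf.length < M → Produces M (buf ++ [x]) inp S → Produces M buf (x :: inp) S
  | write {b₁ b₂ inp S : List α} {x : α} :
      Produces M (b₁ ++ b₂) inp S → Produces M (b₁ ++ x :: b₂) inp (x :: S)

/-- `OPT(I)`: the minimum number of runs over all outputs that are possible on input `I` with a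
buffer of size `M`. -/
noncomputable def opt {α : Type*} [LinearOrder α] (M : ℕ) (I : List α) : ℕ :=
  sInf {n | ∃ S : List α, Produces M [] I S ∧ numRuns S = n}

/-! ## Proper (maximal-run) outputs and nearly sorted inputs -/

/-- `MaximalRun le last buf inp r buf' inp'`: from buffer `buf` and remaining input `inp`, when
`last` is the last element already written to the current run (`none` if the run is about to
start), the rest of the maximal run in the direction of `le` is `r`, and it leaves buffer `buf'` and
remaining input `inp'`.  One always writes the `le`-least buffered element that can continue the
run; the freed slot is refilled with the next input element, if there is one; the run ends only
when no buffered element can continue it. -/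
inductive MaximalRun {α : Type*} [DecidableEq α] (le : α → α → Prop) :
    Option α → List α → List α → List α → List α → List α → Prop
  | finish {last : Option α} {buf inp : List α} :
      (∀ y ∈ buf, ∃ l ∈ last, ¬ le l y) → MaximalRun le last buf inp [] buf inp
  | step {last : Option α} {buf inp r buf' inp' : List α} {x : α} :
      x ∈ buf → (∀ l ∈ last, le l x) →
      (∀ y ∈ buf, (∀ l ∈ last, le l y) → le x y) →
      MaximalRun le (some x) (buf.erase x ++ inp.take 1) (inp.drop 1) r buf' inp' →
      MaximalRun le last buf inp (x :: r) buf' inp'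

/-- `ProperRuns buf inp rs`: from a decision point with buffer `buf` and remaining input `inp`, some
proper algorithm writes successively the maximal runs listed in `rs`, and then nothing is left. -/
inductive ProperRuns {α : Type*} [LinearOrder α] : List α → List α → List (List α) → Prop
  | done : ProperRuns [] [] []
  | up {buf inp r buf' inp' : List α} {rs : List (List α)} :
      buf ≠ [] → MaximalRun (fun a b => a ≤ b) none buf inp r buf' inp' →
      ProperRuns buf' inp' rs → ProperRuns buf inp (r :: rs)
  | down {buf inp r buf' inp' : List α} {rs : List (List α)} :
      buf ≠ [] → MaximalRun (fun a b => b ≤ a) none buf inp r buf' inp' →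
      ProperRuns buf' inp' rs → ProperRuns buf inp (r :: rs)

/-- `I` is `c`-nearly-sorted (for buffer size `M`): some proper algorithm has an optimal output on
`I`, all of whose runs have length at least `c * M`.  The buffer initially holds the first `M`
elements. -/
def NearlySorted {α : Type*} [LinearOrder α] (c M : ℕ) (I : List α) : Prop :=
  ∃ rs : List (List α), ProperRuns (I.take M) (I.drop M) rs ∧
    numRuns rs.flatten = opt M I ∧ ∀ r ∈ rs, c * M ≤ r.length

/-! ## Randomized online algorithms with bounded memory -/

/-- One elementary action of an online algorithm.
* `read p q`: transfer the next input element to the buffer and go to state `p`; if the input is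
  exhausted, go to state `q` instead.
* `write x q`: eject `x` from the buffer, append it to the output, and go to state `q`.
* `store s q`: overwrite the scratch memory by `s` and go to state `q`. -/
inductive Action (α σ : Type*)
  | read (p q : σ)
  | write (x : α) (q : σ)
  | store (s : List α) (q : σ)

/-- A randomized online algorithm.  Its memory consists of a buffer, which holds exactly the
elements that have been read and not yet written, of a scratch memory, which holds copies of
elements, and of an internal state from a finite set.  The (random) next action depends on these
only: the algorithm can inspect neither the remaining input nor the output. -/
structure OnlineAlgorithm (α : Type*) where
  /-- the internal states -/
  State : Type
  /-- there are finitely many internal states -/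
  [fintypeState : Fintype State]
  /-- the initial state -/
  init : State
  /-- `policy q buf scratch` is the law of the next action -/
  policy : State → List α → List α → PMF (Action α State)
  /-- only elements that are present in memory can be copied -/
  store_subset : ∀ (q : State) (buf scratch s : List α) (q' : State),
    Action.store s q' ∈ (policy q buf scratch).support → s ⊆ buf ++ scratch

/-- A configuration: remaining input, buffer (in arrival order), scratch memory, internal state, and
the output written so far. -/
structure Config (α σ : Type*) where
  input : List α
  buf : List α
  scratch : List α
  state : σ
  out : List α

/-- The effect of an action. Trying to write an element that is not in the buffer writes nothing. -/
def Action.apply {α σ : Type*} [DecidableEq α] : Action α σ → Config α σ → Config α σ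
  | .read p q, c =>
      match c.input with
      | [] => { c with state := q }
      | x :: xs => { c with input := xs, buf := c.buf ++ [x], state := p }
  | .write x q, c =>
      if x ∈ c.buf then { c with buf := c.buf.erase x, out := c.out ++ [x], state := q }
      else { c with state := q }
  | .store s q, c => { c with scratch := s, state := q }

namespace OnlineAlgorithm

variable {α : Type*} [DecidableEq α] (A : OnlineAlgorithm α)

/-- The law of the configuration after one more action. -/
noncomputable def step (c : Config α A.State) : PMF (Config α A.State) :=
  (A.policy c.state c.buf c.scratch).map (fun a => a.apply c)

/-- The law of the configuration after `n` actions on input `I`, starting with empty memory. -/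
noncomputable def run (I : List α) : ℕ → PMF (Config α A.State)
  | 0 => PMF.pure ⟨I, [], [], A.init, []⟩
  | n + 1 => (run I n).bind A.step

/-- `A` has a buffer of size `M`, extra space for `E` elements in addition to its buffer, and `w`
additional words: on every input and for all random choices, at every time the buffer holds at most
`M` elements, buffer and scratch memory together hold at most `M + E + w` elements, and the internal
state fits into `w` words, each of which takes `M + 2` values. -/
def UsesSpace (M E w : ℕ) : Prop :=
  Nat.card A.State ≤ (M + 2) ^ w ∧
  ∀ (I : List α) (n : ℕ), ∀ c ∈ (A.run I n).support,
    c.buf.length ≤ M ∧ c.buf.length + c.scratch.length ≤ M + E + w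

/-- For all random choices, `A` has written all of `I` after at most `T` actions. -/
def FinishesBy (I : List α) (T : ℕ) : Prop :=
  ∀ c ∈ (A.run I T).support, c.input = [] ∧ c.buf = []

end OnlineAlgorithm

/-- The expected number of runs in what `A` has written on input `I` after `T` actions. -/
noncomputable def OnlineAlgorithm.expectedRuns {α : Type*} [LinearOrder α]
    (A : OnlineAlgorithm α) (I : List α) (T : ℕ) : ℝ≥0∞ :=
  ∑' c : Config α A.State, A.run I T c * (numRuns c.out : ℝ≥0∞)

end RunGen

/-!
The algorithm follows the optimal proper algorithm from one of its decision points to the next.  At a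
decision point with buffer `V` it chooses a direction `a` by a fair coin, writes the maximal run of
direction `a`, and simulates the maximal run of the other direction on a copy of `V`; both runs read
the same input elements at the same times.  At most one of the two runs has length `3M` or more
(`not_both_long`), so on a `3`-nearly-sorted input the run of the optimal algorithm is the one which
ends later, and the algorithm sees which one this is.

If the coin was right, one run leads to the next decision point.  If it was wrong, the run being
written ends first.  The elements of the buffer that are missing in the simulated buffer are elements
which the simulated run has already written.  So the algorithm can write them in the direction of
that run and then go on with the rest of it, all in one run, and it reaches the next decision point
at a cost of two runs (`coinAlgorithm.reaches_of_wrong_choice`).  From then on, the actual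
buffer is only a part of the virtual buffer `V`, since some elements of `V` have been written before.
The scratch memory holds the missing elements, and the algorithm skips them when the virtual run
writes them.  The missing elements and the buffer together have the size of `V`, and so has the
simulated buffer, so that all this fits into `2M` cells and two more for the last elements of the two
runs.

So each run of the optimal algorithm costs one or two runs with probability `1/2` each
(`coinAlgorithm.eventually_runBound`).  Finally, the concatenation of the runs of a proper algorithm
cannot be split into fewer runs if these are long: the last two elements of such a run and the first
element of the next one are not monotone, so that each partition has a cut between them
(`ProperRuns.length_le_numRuns`).
-/

namespace RunGen

section Runs

variable {α : Type*} [LinearOrder α]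

/-! ### Directions -/

/-- The order in which a run of direction `b` is written: increasing for `true`, decreasing for
`false`. -/
def DirLE : Bool → α → α → Prop
  | true, x, y => x ≤ y
  | false, x, y => y ≤ x

instance (b : Bool) (x y : α) : Decidable (DirLE b x y) := by
  cases b <;> unfold DirLE <;> infer_instance

theorem DirLE.refl (b : Bool) (x : α) : DirLE b x x := by
  cases b <;> exact le_refl x

theorem DirLE.trans {b : Bool} {x y z : α} (h : DirLE b x y) (h' : DirLE b y z) :
    DirLE b x z := by
  cases b
  · exact le_trans (α := α) h' h
  · exact le_trans (α := α) h h'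

theorem isRun_of_pairwise_dirLE {b : Bool} {l : List α} (h : l.Pairwise (DirLE b)) :
    IsRun l := by
  cases b
  · exact Or.inr h
  · exact Or.inl h

/-- The element of `l` that comes first in direction `b`. -/
def least (b : Bool) (l : List α) : Option α :=
  if b then l.min? else l.max?

theorem least_eq_some_iff {b : Bool} {l : List α} {x : α} :
    least b l = some x ↔ x ∈ l ∧ ∀ y ∈ l, DirLE b x y := by
  cases b
  · simp [least, DirLE, List.max?_eq_some_iff]
  · simp [least, DirLE, List.min?_eq_some_iff]

theorem least_eq_none_iff {b : Bool} {l : List α} : least b l = none ↔ l = [] := by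
  cases b <;> simp [least]

/-- The element of `l` that continues a maximal run of direction `b` whose last element is `w`. -/
def next (b : Bool) (w : α) (l : List α) : Option α :=
  least b (l.filter (fun x => DirLE b w x))

theorem next_eq_some_iff {b : Bool} {w x : α} {l : List α} :
    next b w l = some x ↔ x ∈ l ∧ DirLE b w x ∧ ∀ y ∈ l, DirLE b w y → DirLE b x y := by
  simp [next, least_eq_some_iff, and_assoc]

theorem next_eq_none_iff {b : Bool} {w : α} {l : List α} :
    next b w l = none ↔ ∀ y ∈ l, ¬ DirLE b w y := by
  simp [next, least_eq_none_iff]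

theorem next_congr {b : Bool} {w : α} {l l' : List α} (h : l.Perm l') :
    next b w l = next b w l' := by
  refine Option.ext fun x => ?_
  rw [next_eq_some_iff, next_eq_some_iff]
  simp [h.mem_iff]

/-! ### Partial runs -/

/-- `Steps b w V inp r w' V' inp'`: with buffer `V`, remaining input `inp` and last written element
`w`, a maximal run of direction `b` continues with the elements of `r` (and is possibly not finished
with them), after which the last written element is `w'`, the buffer is `V'` and the remaining input
is `inp'`. -/
inductive Steps (b : Bool) :
    α → List α → List α → List α → α → List α → List α → Prop
  | nil {w : α} {V inp : List α} : Steps b w V inp [] w V inp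
  | cons {w x w' : α} {V inp r V' inp' : List α} :
      next b w V = some x → Steps b x (V.erase x ++ inp.take 1) (inp.drop 1) r w' V' inp' →
      Steps b w V inp (x :: r) w' V' inp'

namespace Steps

variable {b : Bool} {w w' : α} {V inp r V' inp' : List α}

theorem input_eq (h : Steps b w V inp r w' V' inp') : inp' = inp.drop r.length := by
  induction h with
  | nil => simp
  | cons _ _ ih => rw [ih, List.drop_drop, List.length_cons, add_comm]

/-- What has been read is what has been written together with what is in the buffer. -/
theorem perm (h : Steps b w V inp r w' V' inp') :
    (V ++ inp.take r.length).Perm (r ++ V') := by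
  induction h with
  | nil => simp
  | @cons w x w' V inp r V' inp' hx _ ih =>
    have hxV : x ∈ V := (next_eq_some_iff.1 hx).1
    have htake : inp.take (r.length + 1) = inp.take 1 ++ (inp.drop 1).take r.length := by
      rw [add_comm, List.take_add]
    rw [List.length_cons, htake]
    calc (V ++ (inp.take 1 ++ (inp.drop 1).take r.length)).Perm
          ((x :: V.erase x) ++ (inp.take 1 ++ (inp.drop 1).take r.length)) :=
            (List.perm_cons_erase hxV).append_right _
      _ = x :: ((V.erase x ++ inp.take 1) ++ (inp.drop 1).take r.length) := by simp
      _ |>.Perm (x :: (r ++ V')) := ih.cons x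

theorem perm_append_input (h : Steps b w V inp r w' V' inp') :
    (V ++ inp).Perm (r ++ (V' ++ inp')) := by
  have := h.perm.append_right (inp.drop r.length)
  rwa [List.append_assoc, List.take_append_drop, List.append_assoc, ← h.input_eq] at this

theorem pairwise (h : Steps b w V inp r w' V' inp') : (w :: r).Pairwise (DirLE b) := by
  induction h with
  | nil => simp
  | cons hx _ ih =>
    have hwx := (next_eq_some_iff.1 hx).2.1
    refine List.pairwise_cons.2 ⟨fun y hy => ?_, ih⟩
    rcases List.mem_cons.1 hy with rfl | hy
    · exact hwx
    · exact hwx.trans ((List.pairwise_cons.1 ih).1 y hy)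

theorem dirLE_last (h : Steps b w V inp r w' V' inp') : ∀ y ∈ w :: r, DirLE b y w' := by
  induction h with
  | nil => simpa using DirLE.refl _ _
  | cons hx _ ih =>
    intro y hy
    rcases List.mem_cons.1 hy with rfl | hy
    · exact (next_eq_some_iff.1 hx).2.1.trans (ih _ (by simp))
    · exact ih y hy

/-- The `i`-th element of a run is written before the `i`-th refill of the buffer. -/
theorem subset (h : Steps b w V inp r w' V' inp') : r ⊆ V ++ inp.take (r.length - 1) := by
  induction h with
  | nil => simp
  | @cons w x w' V inp r V' inp' hx _ ih =>
    intro y hy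
    rcases List.mem_cons.1 hy with rfl | hy
    · exact List.mem_append_left _ (next_eq_some_iff.1 hx).1
    · have hpos : 1 ≤ r.length := List.length_pos_of_mem hy
      have htake : inp.take r.length = inp.take 1 ++ (inp.drop 1).take (r.length - 1) := by
        rw [← List.take_add]; congr 1; omega
      have := ih hy
      rw [List.length_cons, Nat.add_sub_cancel, htake]
      simp only [List.mem_append] at this ⊢
      rcases this with (h | h) | h
      · exact Or.inl (List.mem_of_mem_erase h)
      · exact Or.inr (Or.inl h)
      · exact Or.inr (Or.inr h)

theorem split {r₁ r₂ : List α} (h : Steps b w V inp (r₁ ++ r₂) w' V' inp') :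
    ∃ w₁ V₁ inp₁, Steps b w V inp r₁ w₁ V₁ inp₁ ∧ Steps b w₁ V₁ inp₁ r₂ w' V' inp' := by
  induction r₁ generalizing w V inp with
  | nil => exact ⟨w, V, inp, .nil, h⟩
  | cons x r₁ ih =>
    cases h with
    | cons hx h =>
      obtain ⟨w₁, V₁, inp₁, h₁, h₂⟩ := ih h
      exact ⟨w₁, V₁, inp₁, .cons hx h₁, h₂⟩

theorem nodup (h : Steps b w V inp r w' V' inp') (hnd : (V ++ inp).Nodup) : r.Nodup :=
  (List.nodup_append.1 (h.perm_append_input.nodup_iff.1 hnd)).1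

theorem nodup_rest (h : Steps b w V inp r w' V' inp') (hnd : (V ++ inp).Nodup) :
    (V' ++ inp').Nodup :=
  (List.nodup_append.1 (h.perm_append_input.nodup_iff.1 hnd)).2.1

/-- The buffer remains full until the input is exhausted. -/
theorem full_rest (h : Steps b w V inp r w' V' inp') {M : ℕ}
    (hV : V.length = M ∨ V.length ≤ M ∧ inp = []) :
    V'.length = M ∨ V'.length ≤ M ∧ inp' = [] := by
  have h₁ := h.perm.length_eq
  have h₂ := h.input_eq
  rw [List.length_append, List.length_append, List.length_take] at h₁
  by_cases hr : r.length ≤ inp.length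
  · rcases hV with hV | ⟨hV, rfl⟩
    · left; omega
    · right; simp at hr h₁ h₂ ⊢; exact ⟨by simp [hr] at h₁; omega, h₂⟩
  · right
    exact ⟨by rcases hV with hV | ⟨hV, -⟩ <;> omega,
      by rw [h₂]; exact List.drop_eq_nil_of_le (by omega)⟩

end Steps

/-- A run goes on for `n` elements, unless it ends earlier. -/
theorem exists_steps (b : Bool) (w : α) (V inp : List α) (n : ℕ) :
    ∃ r w' V' inp', Steps b w V inp r w' V' inp' ∧
      (r.length = n ∨ r.length < n ∧ next b w' V' = none) := by
  induction n generalizing w V inp with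
  | zero => exact ⟨[], w, V, inp, .nil, Or.inl rfl⟩
  | succ n ih =>
    rcases hx : next b w V with _ | x
    · exact ⟨[], w, V, inp, .nil, Or.inr ⟨by simp, hx⟩⟩
    · obtain ⟨r, w', V', inp', h, h'⟩ := ih x (V.erase x ++ inp.take 1) (inp.drop 1)
      exact ⟨x :: r, w', V', inp', .cons hx h, by simpa using h'⟩

theorem MaximalRun.steps {b : Bool} {w : α} {V inp r V' inp' : List α}
    (h : MaximalRun (DirLE b) (some w) V inp r V' inp') :
    ∃ w', Steps b w V inp r w' V' inp' ∧ next b w' V' = none := by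
  generalize hl : some w = last at h
  induction h generalizing w with
  | finish h =>
    subst hl
    exact ⟨w, .nil, next_eq_none_iff.2 (by simpa using h)⟩
  | step hx hlx hmin _ ih =>
    subst hl
    obtain ⟨w', hs, hn⟩ := ih rfl
    refine ⟨w', .cons (next_eq_some_iff.2 ⟨hx, by simpa using hlx, ?_⟩) hs, hn⟩
    simpa using hmin

/-- At the start of a run, the first element to be written may count as the last written one. -/
theorem MaximalRun.steps_of_least {b : Bool} {w : α} {V inp r V' inp' : List α}
    (h : MaximalRun (DirLE b) none V inp r V' inp') (hw : least b V = some w) :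
    ∃ w', Steps b w V inp r w' V' inp' ∧ next b w' V' = none := by
  obtain ⟨hwV, hmin⟩ := least_eq_some_iff.1 hw
  cases h with
  | finish h => obtain ⟨_, hl, -⟩ := h w hwV; cases hl
  | step hx _ hxmin h =>
    refine MaximalRun.steps (.step hx ?_ ?_ h)
    · rintro _ ⟨⟩; exact hmin _ hx
    · intro y hy _; exact hxmin y hy (by simp)

/-! ### Only one of the two runs that start at a decision point is long -/

/-- Both runs write `M` of the at most `2M - 1` elements that are read before their `M`-th write, so
they have some `z` among these elements in common.  Elements which both runs write later have to be
on both sides of `z`.  So the runs share at most `2M - 1` elements; but if each of them writes `3M`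
of the at most `4M - 1` elements that are then available, then they share at least `2M + 1`. -/
theorem not_both_long {M : ℕ} (hM : 1 ≤ M) {V inp r s : List α} (hV : V.length ≤ M)
    (hr : r.Pairwise (· ≤ ·)) (hs : s.Pairwise (fun x y => y ≤ x))
    (hrn : r.Nodup) (hsn : s.Nodup) (hrl : r.length = 3 * M) (hsl : s.length = 3 * M)
    (hrM : r.take M ⊆ V ++ inp.take (M - 1)) (hsM : s.take M ⊆ V ++ inp.take (M - 1))
    (hr3 : r ⊆ V ++ inp.take (3 * M - 1)) (hs3 : s ⊆ V ++ inp.take (3 * M - 1)) : False := by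
  have card_le (n : ℕ) : (V ++ inp.take n).toFinset.card ≤ M + n := by
    refine (List.toFinset_card_le _).trans ?_
    rw [List.length_append, List.length_take]
    omega
  have hrc : r.toFinset.card = 3 * M := by rw [List.toFinset_card_of_nodup hrn, hrl]
  have hsc : s.toFinset.card = 3 * M := by rw [List.toFinset_card_of_nodup hsn, hsl]
  have hrtc : (r.take M).toFinset.card = M := by
    rw [List.toFinset_card_of_nodup (hrn.sublist (List.take_sublist _ _)), List.length_take]; omega
  have hstc : (s.take M).toFinset.card = M := by
    rw [List.toFinset_card_of_nodup (hsn.sublist (List.take_sublist _ _)), List.length_take]; omega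
  have toFinset_mono {l l' : List α} (h : l ⊆ l') : l.toFinset ⊆ l'.toFinset := by
    intro x hx; simpa using h (by simpa using hx)
  obtain ⟨z, hzr, hzs⟩ : ∃ z, z ∈ r.take M ∧ z ∈ s.take M := by
    by_contra! hdisj
    have hd : Disjoint (r.take M).toFinset (s.take M).toFinset :=
      Finset.disjoint_left.2 fun x hx hx' => hdisj x (by simpa using hx) (by simpa using hx')
    have h₁ := Finset.card_union_of_disjoint hd
    have h₂ := (Finset.card_le_card (Finset.union_subset (toFinset_mono hrM)
      (toFinset_mono hsM))).trans (card_le _)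
    omega
  have hshared : r.toFinset ∩ s.toFinset ⊆ (V ++ inp.take (M - 1)).toFinset := by
    intro e he
    rw [Finset.mem_inter, List.mem_toFinset, List.mem_toFinset] at he
    rw [List.mem_toFinset]
    rw [← List.take_append_drop M r, ← List.take_append_drop M s, List.mem_append,
      List.mem_append] at he
    rw [← List.take_append_drop M r] at hr
    rw [← List.take_append_drop M s] at hs
    rcases he with ⟨her | her, hes | hes⟩
    · exact hrM her
    · exact hrM her
    · exact hsM hes
    · have h₁ := (List.pairwise_append.1 hr).2.2 z hzr e her
      have h₂ := (List.pairwise_append.1 hs).2.2 z hzs e hes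
      rw [le_antisymm h₂ h₁]
      exact hrM hzr
  have h₁ := (Finset.card_le_card hshared).trans (card_le _)
  have h₂ := (Finset.card_le_card (Finset.union_subset (toFinset_mono hr3)
    (toFinset_mono hs3))).trans (card_le _)
  have h₃ := Finset.card_union_add_card_inter r.toFinset s.toFinset
  omega

/-- If the maximal run in one direction writes at least `3M` elements, then the one in the other
direction ends before that. -/
theorem exists_short_steps {M : ℕ} (hM : 1 ≤ M) {b : Bool} {w v w' : α} {V inp r V' inp' : List α}
    (hV : V.length ≤ M) (hnd : (V ++ inp).Nodup) (h : Steps b w V inp r w' V' inp')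
    (hr : 3 * M ≤ r.length) :
    ∃ s v' D inp₁, Steps (!b) v V inp s v' D inp₁ ∧ next (!b) v' D = none ∧
      s.length < r.length := by
  obtain ⟨s, v', D, inp₁, hs, hl | ⟨hl, hn⟩⟩ := exists_steps (!b) v V inp (3 * M)
  swap
  · exact ⟨s, v', D, inp₁, hs, hn, by omega⟩
  exfalso
  obtain ⟨w₁, V₁, inp₂, hr', -⟩ := (List.take_append_drop (3 * M) r ▸ h).split
  set r' := r.take (3 * M) with hr'_def
  have hrl : r'.length = 3 * M := by rw [hr'_def, List.length_take]; omega
  have take_subset {b : Bool} {w w' : α} {r V' inp' : List α} (h : Steps b w V inp r w' V' inp')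
      (hl : r.length = 3 * M) : r.take M ⊆ V ++ inp.take (M - 1) := by
    obtain ⟨_, _, _, h', -⟩ := (List.take_append_drop M r ▸ h).split
    have := h'.subset
    rwa [List.length_take, min_eq_left (by omega)] at this
  have hp₁ := (List.pairwise_cons.1 hr'.pairwise).2
  have hp₂ := (List.pairwise_cons.1 hs.pairwise).2
  have hs₁ := hr'.subset
  have hs₂ := hs.subset
  rw [hrl] at hs₁
  rw [hl] at hs₂
  cases b
  · exact not_both_long hM hV hp₂ hp₁ (hs.nodup hnd) (hr'.nodup hnd) hl hrl (take_subset hs hl)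
      (take_subset hr' hrl) hs₂ hs₁
  · exact not_both_long hM hV hp₁ hp₂ (hr'.nodup hnd) (hs.nodup hnd) hrl hl (take_subset hr' hrl)
      (take_subset hs hl) hs₁ hs₂

/-! ### Counting runs -/

theorem numRuns_flatten_le {parts : List (List α)} (h : ∀ p ∈ parts, IsRun p) :
    numRuns parts.flatten ≤ parts.length :=
  Nat.sInf_le ⟨parts, rfl, rfl, h⟩

/-- A partition into runs has a cut inside each triple that is not a run. -/
theorem exists_cut {parts : List (List α)} (hp : ∀ p ∈ parts, IsRun p) {A C : List α} {a b c : α}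
    (habc : ¬ IsRun [a, b, c]) (h : parts.flatten = A ++ a :: b :: c :: C) :
    ∃ P Q, parts = P ++ Q ∧ P ≠ [] ∧
      (Q.flatten = b :: c :: C ∨ Q.flatten = c :: C) := by
  induction parts generalizing A with
  | nil => simp at h
  | cons p ps ih =>
    have of_tail {A' : List α} (h' : ps.flatten = A' ++ a :: b :: c :: C) :
        ∃ P Q, p :: ps = P ++ Q ∧ P ≠ [] ∧ (Q.flatten = b :: c :: C ∨ Q.flatten = c :: C) := by
      obtain ⟨P, Q, hPQ, -, hQ⟩ := ih (fun q hq => hp q (by simp [hq])) h'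
      exact ⟨p :: P, Q, by simp [hPQ], by simp, hQ⟩
    rw [List.flatten_cons, List.append_eq_append_iff] at h
    rcases h with ⟨A', -, h⟩ | ⟨p', rfl, h⟩
    · exact of_tail h
    · match p', h with
      | [], h => exact of_tail (A' := []) (by simpa using h.symm)
      | [_], h =>
        simp only [List.cons_append, List.nil_append, List.cons.injEq] at h
        exact ⟨[_], ps, rfl, by simp, Or.inl h.2.symm⟩
      | [_, _], h =>
        simp only [List.cons_append, List.nil_append, List.cons.injEq] at h
        exact ⟨[_], ps, rfl, by simp, Or.inr h.2.2.symm⟩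
      | _ :: _ :: _ :: p'', h =>
        simp only [List.cons_append, List.cons.injEq] at h
        obtain ⟨rfl, rfl, rfl, -⟩ := h
        have hsub : [a, b, c].Sublist (A ++ a :: b :: c :: p'') :=
          (show [a, b, c].Sublist (a :: b :: c :: p'') by simp).trans
            (List.sublist_append_right _ _)
        exact absurd ((hp _ (by simp)).imp (List.Pairwise.sublist hsub)
          (List.Pairwise.sublist hsub)) habc

/-- The last two elements of a maximal run and the first element of the next run do not form a
run. -/
theorem not_isRun_of_turn {d : Bool} {x y z : α} (hxy : DirLE d x y) (hne : x ≠ y)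
    (hyz : ¬ DirLE d y z) : ¬ IsRun [x, y, z] := by
  cases d <;> simp only [DirLE, not_le] at hxy hyz <;> simp only [IsRun, List.pairwise_cons] <;>
    rintro (h | h)
  · exact hne (le_antisymm (h.1 y (by simp)) hxy)
  · exact absurd (h.2.1 z (by simp)) (not_le.2 hyz)
  · exact absurd (h.2.1 z (by simp)) (not_le.2 hyz)
  · exact hne (le_antisymm hxy (h.1 y (by simp)))

theorem ProperRuns.exists_maximalRun {V inp r : List α} {rs : List (List α)}
    (h : ProperRuns V inp (r :: rs)) :
    ∃ b V' inp', V ≠ [] ∧ MaximalRun (DirLE b) none V inp r V' inp' ∧ ProperRuns V' inp' rs := by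
  cases h with
  | up h₁ h₂ h₃ => exact ⟨true, _, _, h₁, h₂, h₃⟩
  | down h₁ h₂ h₃ => exact ⟨false, _, _, h₁, h₂, h₃⟩

theorem ProperRuns.exists_steps {V inp r : List α} {rs : List (List α)}
    (h : ProperRuns V inp (r :: rs)) :
    ∃ b w w' V' inp', least b V = some w ∧ Steps b w V inp r w' V' inp' ∧ next b w' V' = none ∧
      ProperRuns V' inp' rs := by
  obtain ⟨b, V', inp', hV, h, h'⟩ := h.exists_maximalRun
  obtain ⟨w, hw⟩ : ∃ w, least b V = some w :=
    Option.ne_none_iff_exists'.1 (mt least_eq_none_iff.1 hV)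
  obtain ⟨w', hs, hn⟩ := h.steps_of_least hw
  exact ⟨b, w, w', V', inp', hw, hs, hn, h'⟩

theorem ProperRuns.length_le_of_partition {V inp : List α} {rs : List (List α)}
    (h : ProperRuns V inp rs) (hnd : (V ++ inp).Nodup) (hlong : ∀ r ∈ rs, 3 ≤ r.length)
    {parts : List (List α)} (hp : ∀ p ∈ parts, IsRun p) {A : List α}
    (hA : parts.flatten = A ++ rs.flatten) : rs.length ≤ parts.length := by
  induction rs generalizing V inp parts A with
  | nil => simp
  | cons r rs ih =>
    obtain ⟨d, w, w', V', inp', -, hs, hn, h'⟩ := h.exists_steps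
    have hr3 := hlong r (by simp)
    cases rs with
    | nil =>
      have : parts ≠ [] := by
        rintro rfl
        have := congrArg List.length hA
        simp at this
        omega
      simpa [Nat.one_le_iff_ne_zero] using this
    | cons r' rs =>
      -- the first element of the next run is stuck when the first run ends
      obtain ⟨d', _, _, _, _, _, hs', _, _⟩ := h'.exists_steps
      have hr3' := hlong r' (by simp)
      obtain ⟨z, r'', rfl⟩ := List.exists_cons_of_length_pos (by omega : 0 < r'.length)
      have hz : z ∈ V' := by cases hs' with | cons hx _ => exact (next_eq_some_iff.1 hx).1
      obtain ⟨r₁, y, rfl⟩ := List.eq_nil_or_concat'  r |>.resolve_left (by rintro rfl; simp at hr3)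
      obtain ⟨r₀, x, rfl⟩ := List.eq_nil_or_concat' r₁ |>.resolve_left (by rintro rfl; simp at hr3)
      have hyz : ¬ DirLE d y z := fun hyz => by
        obtain ⟨w₁, V₁, inp₁, -, h₂⟩ := hs.split
        cases h₂ with
        | cons _ h₂ => cases h₂; exact next_eq_none_iff.1 hn z hz hyz
      have hxy : DirLE d x y := by
        have := (List.pairwise_cons.1 hs.pairwise).2
        exact (List.pairwise_append.1 this).2.2 x (by simp) y (by simp)
      have hne : x ≠ y := by
        have := List.nodup_append.1 (hs.nodup hnd)
        exact this.2.2 x (by simp) y (by simp)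
      obtain ⟨P, Q, rfl, hP, hQ⟩ := exists_cut hp (A := A ++ r₀) (C := r'' ++ rs.flatten)
        (not_isRun_of_turn hxy hne hyz) (by simpa using hA)
      have hPl : 1 ≤ P.length := List.length_pos_iff.2 hP
      have hQl : (((z :: r'') :: rs).length ≤ Q.length) := by
        rcases hQ with hQ | hQ
        · exact ih h' (hs.nodup_rest hnd) (fun r hr => hlong r (by simp [hr]))
            (fun p hp' => hp p (by simp [hp'])) (A := [y]) (by simpa using hQ)
        · exact ih h' (hs.nodup_rest hnd) (fun r hr => hlong r (by simp [hr]))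
            (fun p hp' => hp p (by simp [hp'])) (A := []) (by simpa using hQ)
      simp only [List.length_cons, List.length_append] at hQl ⊢
      omega

/-- If all runs are long, then no partition into runs beats the one into the maximal runs. -/
theorem ProperRuns.length_le_numRuns {V inp : List α} {rs : List (List α)}
    (h : ProperRuns V inp rs) (hnd : (V ++ inp).Nodup) (hlong : ∀ r ∈ rs, 3 ≤ r.length) :
    rs.length ≤ numRuns rs.flatten := by
  refine le_csInf ⟨rs.flatten.length, rs.flatten.map (fun x => [x]), List.length_map _, ?_, ?_⟩ ?_
  · induction rs.flatten <;> simp_all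
  · intro p hp
    obtain ⟨x, -, rfl⟩ := List.mem_map.1 hp
    exact Or.inl (List.pairwise_singleton _ _)
  · rintro n ⟨parts, rfl, hparts, hp⟩
    exact h.length_le_of_partition hnd hlong hp (A := []) (by simpa using hparts)

end Runs

/-! ### Laws of configurations and eventual properties -/

namespace OnlineAlgorithm

section Law

variable {α : Type*} [DecidableEq α] (A : OnlineAlgorithm α)

/-- The law of the configuration after `n` more actions, starting with configuration `c`. -/
noncomputable def lawFrom : ℕ → Config α A.State → PMF (Config α A.State)
  | 0, c => PMF.pure c
  | n + 1, c => (A.step c).bind (lawFrom n)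

theorem lawFrom_succ' (n : ℕ) (c : Config α A.State) :
    A.lawFrom (n + 1) c = (A.lawFrom n c).bind A.step := by
  induction n generalizing c with
  | zero => simp [lawFrom]
  | succ n ih =>
    change (A.step c).bind (A.lawFrom (n + 1)) = ((A.step c).bind (A.lawFrom n)).bind A.step
    rw [PMF.bind_bind, funext ih]

theorem run_eq_lawFrom (I : List α) (n : ℕ) :
    A.run I n = A.lawFrom n ⟨I, [], [], A.init, []⟩ := by
  induction n with
  | zero => rfl
  | succ n ih => rw [run, lawFrom_succ', ih]

/-- `A` passes from one configuration to the other by actions that involve no random choice. -/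
def Reaches : Config α A.State → Config α A.State → Prop :=
  Relation.ReflTransGen (fun c c' => A.step c = PMF.pure c')

/-- From some time on, the law of the configuration of `A` when started in `c` satisfies `Q`. -/
def Eventually (Q : PMF (Config α A.State) → Prop) (c : Config α A.State) : Prop :=
  ∃ T, ∀ n, T ≤ n → Q (A.lawFrom n c)

variable {A}

theorem Reaches.refl (c : Config α A.State) : A.Reaches c c :=
  Relation.ReflTransGen.refl

theorem Reaches.trans {c c' c'' : Config α A.State} (h : A.Reaches c c') (h' : A.Reaches c' c'') :
    A.Reaches c c'' :=
  Relation.ReflTransGen.trans h h'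

theorem Reaches.eventually {Q : PMF (Config α A.State) → Prop} {c c' : Config α A.State}
    (h : A.Reaches c c') (hQ : A.Eventually Q c') : A.Eventually Q c := by
  induction h using Relation.ReflTransGen.head_induction_on with
  | refl => exact hQ
  | head h _ ih =>
    obtain ⟨T, hT⟩ := ih
    refine ⟨T + 1, fun n hn => ?_⟩
    obtain ⟨n, rfl⟩ := Nat.exists_eq_succ_of_ne_zero (by omega : n ≠ 0)
    rw [Nat.succ_eq_add_one, lawFrom, h, PMF.pure_bind]
    exact hT n (by omega)

theorem lawFrom_eq_pure_of_step_eq {c : Config α A.State} (h : A.step c = PMF.pure c) (n : ℕ) :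
    A.lawFrom n c = PMF.pure c := by
  induction n with
  | zero => rfl
  | succ n ih => rw [lawFrom, h, PMF.pure_bind, ih]

theorem eventually_of_step_eq {Q : PMF (Config α A.State) → Prop} {c : Config α A.State}
    (h : A.step c = PMF.pure c) (hQ : Q (PMF.pure c)) : A.Eventually Q c :=
  ⟨0, fun n _ => by rwa [lawFrom_eq_pure_of_step_eq h]⟩

theorem Eventually.of_coin {Q : PMF (Config α A.State) → Prop} {Q' : Bool → _}
    {c : Config α A.State} {c' : Bool → Config α A.State}
    (h : A.step c = (PMF.uniformOfFintype Bool).map c') (hQ' : ∀ g, A.Eventually (Q' g) (c' g))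
    (hQ : ∀ p : Bool → PMF (Config α A.State), (∀ g, Q' g (p g)) →
      Q ((PMF.uniformOfFintype Bool).bind p)) : A.Eventually Q c := by
  choose T hT using hQ'
  refine ⟨max (T true) (T false) + 1, fun n hn => ?_⟩
  obtain ⟨n, rfl⟩ := Nat.exists_eq_succ_of_ne_zero (by omega : n ≠ 0)
  rw [Nat.succ_eq_add_one, lawFrom, h, PMF.bind_map]
  refine hQ _ fun g => hT g n ?_
  cases g <;> omega

end Law

end OnlineAlgorithm

/-! ### The algorithm -/

/-- The internal states of the algorithm.  A maximal run of direction `a` is being written, and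
another one of direction `b` is being simulated, in the states `go a b`, `write a b`, `read a b` and
`copy a b`. -/
inductive Phase
  /-- the virtual buffer is filled at a decision point -/
  | fill
  /-- the direction of the next run is chosen -/
  | flip
  /-- the next elements of both runs are determined -/
  | go (a b : Bool)
  /-- the next element is written -/
  | write (a b : Bool)
  /-- the next input element is read -/
  | read (a b : Bool)
  /-- the element just read is copied to the simulated buffer -/
  | copy (a b : Bool)
  /-- the elements which the simulated run of direction `b` has already written are written -/
  | flush (b : Bool)
  deriving DecidableEq, Fintype

theorem card_phase : Nat.card Phase = 20 := by
  rw [Nat.card_eq_fintype_card]; rfl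

section Algorithm

variable {α : Type*} [LinearOrder α]

/-- The next action when the direction `g` has been chosen for the next run.  The scratch memory
receives the elements from which the two runs start, and a copy of the virtual buffer.  If the
virtual buffer is empty, then the algorithm stays in state `flip` forever. -/
def startAction (g : Bool) (B G : List α) : Action α Phase :=
  match least g (B ++ G), least (!g) (B ++ G) with
  | some w, some v => .store (w :: v :: (G ++ (B ++ G))) (.go g (!g))
  | _, _ => .store [] .flip

/-- The next action at a time when the run of direction `a` has last written `w` and has the virtual
buffer `B ++ G`, and the simulated run of direction `b` has last written `v` and has the virtual
buffer `D`. -/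
def goAction (a b : Bool) (w v : α) (B G D : List α) : Action α Phase :=
  match next a w (B ++ G), next b v D with
  | some x, some y =>
      .store (x :: y :: ((if x ∈ B then G else G.erase x) ++ D.erase y)) (.write a b)
  | some _, none => .store (w :: w :: (G ++ (B ++ G))) (.go a a)
  | none, some _ => .store (v :: D) (.flush b)
  | none, none => .store G .fill

/-- The next action when the elements of the buffer `B` which are missing in the virtual buffer `D`
are to be written in direction `b`. -/
def flushAction (b : Bool) (v : α) (B D : List α) : Action α Phase :=
  match least b (B.diff D) with
  | some x => .write x (.flush b)
  | none => .store (v :: v :: (D.diff B ++ D)) (.go b b)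

/-- The next action in all states but `flip`.  In state `go a b` the scratch memory holds the last
elements of the two runs, then the list `G` of the elements of the virtual buffer that are missing
in the actual buffer `B`, then the virtual buffer `D` of the simulated run.  As both virtual buffers
have the same size, the length of `G` can be computed.  In state `write a b`, nothing is written if
the element is in `G` only. -/
def nextAction (M : ℕ) : Phase → List α → List α → Action α Phase
  | .fill, B, S => if B.length + S.length < M then .read .fill .flip else .store S .flip
  | .go a b, B, w :: v :: S =>
      goAction a b w v B (S.take ((S.length - B.length) / 2)) (S.drop ((S.length - B.length) / 2))
  | .write a b, _, x :: _ => .write x (.read a b)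
  | .read a b, _, _ => .read (.copy a b) (.go a b)
  | .copy a b, B, S => .store (S ++ B.getLast?.toList) (.go a b)
  | .flush b, B, v :: D => flushAction b v B D
  | _, _, _ => .store [] .fill

theorem startAction_subset {g : Bool} {B G s : List α} {q : Phase}
    (h : startAction g B G = .store s q) : s ⊆ B ++ G := by
  unfold startAction at h
  split at h
  · next w v hw hv =>
    cases h
    have h₁ := (least_eq_some_iff.1 hw).1
    have h₂ := (least_eq_some_iff.1 hv).1
    intro z hz
    simp only [List.mem_cons, List.mem_append] at hz h₁ h₂ ⊢
    grind
  · cases h; simp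

theorem goAction_subset {a b : Bool} {w v : α} {B G D s : List α} {q : Phase}
    (h : goAction a b w v B G D = .store s q) : s ⊆ B ++ w :: v :: (G ++ D) := by
  unfold goAction at h
  split at h
  · next x y hx hy =>
    cases h
    have h₁ := (next_eq_some_iff.1 hx).1
    have h₂ := (next_eq_some_iff.1 hy).1
    have h₃ : ∀ z ∈ (if x ∈ B then G else G.erase x), z ∈ G := by
      intro z hz
      split at hz
      · exact hz
      · exact List.mem_of_mem_erase hz
    have h₄ : ∀ z ∈ D.erase y, z ∈ D := fun z => List.mem_of_mem_erase
    intro z hz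
    simp only [List.mem_cons, List.mem_append] at hz h₁ h₂ ⊢
    grind
  all_goals
    cases h
    intro z hz
    simp only [List.mem_cons, List.mem_append] at hz ⊢
    grind

theorem flushAction_subset {b : Bool} {v : α} {B D s : List α} {q : Phase}
    (h : flushAction b v B D = .store s q) : s ⊆ B ++ v :: D := by
  unfold flushAction at h
  split at h
  · cases h
  · cases h
    have h₁ : ∀ z ∈ D.diff B, z ∈ D := fun z hz => (List.diff_sublist D B).subset hz
    intro z hz
    simp only [List.mem_cons, List.mem_append] at hz ⊢
    grind

theorem nextAction_subset {M : ℕ} {q q' : Phase} {B S s : List α}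
    (h : nextAction M q B S = .store s q') : s ⊆ B ++ S := by
  unfold nextAction at h
  split at h
  · split at h
    · cases h
    · cases h; simp
  · simpa using goAction_subset h
  · cases h
  · cases h
  · cases h
    intro z hz
    rcases List.mem_append.1 hz with hz | hz
    · simp [hz]
    · exact List.mem_append_left _ (List.mem_of_getLast? (by simpa using hz))
  · exact flushAction_subset h
  · cases h; simp

/-- The randomized online algorithm.  It keeps track of the virtual buffer that an optimal proper
algorithm would have; the actual buffer holds a part of it, and the scratch memory the rest. -/
noncomputable abbrev coinAlgorithm (α : Type*) [LinearOrder α] (M : ℕ) : OnlineAlgorithm α where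
  State := Phase
  init := .fill
  policy q B S :=
    if q = .flip then (PMF.uniformOfFintype Bool).map (fun g => startAction g B S)
    else PMF.pure (nextAction M q B S)
  store_subset q B S s q' h := by
    split at h
    · obtain ⟨g, -, hg⟩ := (PMF.mem_support_map_iff _ _ _).1 h
      exact startAction_subset hg
    · rw [PMF.mem_support_pure_iff] at h
      exact nextAction_subset h.symm

namespace coinAlgorithm

variable {M : ℕ}

/-- A configuration of the algorithm. -/
abbrev Conf (α : Type*) := Config α Phase

theorem step_eq {c : Conf α} (h : c.state ≠ .flip) :
    (coinAlgorithm α M).step c =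
      PMF.pure ((nextAction M c.state c.buf c.scratch).apply c) := by
  change (if c.state = .flip then _ else _ : PMF _).map _ = _
  rw [if_neg h, PMF.pure_map]

theorem step_flip {c : Conf α} (h : c.state = .flip) :
    (coinAlgorithm α M).step c =
      (PMF.uniformOfFintype Bool).map (fun g => (startAction g c.buf c.scratch).apply c) := by
  change (if c.state = .flip then _ else _ : PMF _).map _ = _
  rw [if_pos h, PMF.map_comp]
  rfl

theorem step_halt {c : Conf α} (h : c.state = .flip) (hB : c.buf = []) (hS : c.scratch = []) :
    (coinAlgorithm α M).step c = PMF.pure c := by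
  rw [step_flip h]
  have (g : Bool) : (startAction g c.buf c.scratch).apply c = c := by
    have : least g ([] : List α) = none := least_eq_none_iff.2 rfl
    obtain ⟨_, _, _, _, _⟩ := c
    cases h; cases hB; cases hS
    simp [startAction, this, Action.apply]
  simp only [this]
  exact PMF.map_const _ _

theorem reaches_next {c c' : Conf α} (h : c.state ≠ .flip)
    (hc : (nextAction M c.state c.buf c.scratch).apply c = c') :
    (coinAlgorithm α M).Reaches c c' :=
  .single (by rw [step_eq h, hc])

/-! ### What the algorithm does between two coin flips -/

theorem nextAction_go {a b : Bool} {w v : α} {B G D : List α} (hD : D.length = B.length + G.length) :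
    nextAction M (.go a b) B (w :: v :: (G ++ D)) = goAction a b w v B G D := by
  have : ((G ++ D).length - B.length) / 2 = G.length := by
    rw [List.length_append]; omega
  simp only [nextAction, this, List.take_left, List.drop_left]

/-- Both runs advance by one element. -/
theorem reaches_tick {a b : Bool} {w v x y : α} {inp B G D o : List α}
    (hD : D.length = B.length + G.length) (hx : next a w (B ++ G) = some x)
    (hy : next b v D = some y) :
    ∃ G', (B.erase x ++ G').Perm ((B ++ G).erase x) ∧
      (coinAlgorithm α M).Reaches (⟨inp, B, w :: v :: (G ++ D), .go a b, o⟩ : Conf α)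
        ⟨inp.drop 1, B.erase x ++ inp.take 1, x :: y :: (G' ++ (D.erase y ++ inp.take 1)),
          .go a b, o ++ (if x ∈ B then [x] else [])⟩ := by
  refine ⟨if x ∈ B then G else G.erase x, ?_, ?_⟩
  · rw [List.erase_append]
    split
    · rfl
    · next h => rw [List.erase_of_not_mem h]
  set G' := if x ∈ B then G else G.erase x with hG'
  refine OnlineAlgorithm.Reaches.trans (reaches_next (c' :=
    ⟨inp, B, x :: y :: (G' ++ D.erase y), .write a b, o⟩) (by simp) ?_) ?_
  · simp only [nextAction_go hD, goAction, hx, hy]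
    rfl
  refine OnlineAlgorithm.Reaches.trans (reaches_next (c' :=
    ⟨inp, B.erase x, x :: y :: (G' ++ D.erase y), .read a b, o ++ (if x ∈ B then [x] else [])⟩)
    (by simp) ?_) ?_
  · simp only [nextAction, Action.apply]
    split
    · rfl
    · next h => simp [List.erase_of_not_mem h]
  cases inp with
  | nil => exact reaches_next (by simp) (by simp [nextAction, Action.apply])
  | cons z inp =>
    refine OnlineAlgorithm.Reaches.trans (reaches_next (c' :=
      ⟨inp, B.erase x ++ [z], x :: y :: (G' ++ D.erase y), .copy a b,
        o ++ (if x ∈ B then [x] else [])⟩) (by simp) rfl) ?_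
    exact reaches_next (by simp) (by simp [nextAction, Action.apply])

/-- The simulated run ends first. -/
theorem reaches_of_dead_right {a b : Bool} {w v x : α} {inp B G D o : List α}
    (hD : D.length = B.length + G.length) (hx : next a w (B ++ G) = some x)
    (hy : next b v D = none) :
    (coinAlgorithm α M).Reaches (⟨inp, B, w :: v :: (G ++ D), .go a b, o⟩ : Conf α)
      ⟨inp, B, w :: w :: (G ++ (B ++ G)), .go a a, o⟩ :=
  reaches_next (by simp) (by simp only [nextAction_go hD, goAction, hx, hy]; rfl)

/-- Both runs end. -/
theorem reaches_of_dead {a b : Bool} {w v : α} {inp B G D o : List α}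
    (hD : D.length = B.length + G.length) (hx : next a w (B ++ G) = none)
    (hy : next b v D = none) :
    (coinAlgorithm α M).Reaches (⟨inp, B, w :: v :: (G ++ D), .go a b, o⟩ : Conf α)
      ⟨inp, B, G, .fill, o⟩ :=
  reaches_next (by simp) (by simp only [nextAction_go hD, goAction, hx, hy]; rfl)

theorem reaches_flush {b : Bool} {v : α} {inp B D o : List α} :
    ∃ B' t, (coinAlgorithm α M).Reaches (⟨inp, B, v :: D, .flush b, o⟩ : Conf α)
        ⟨inp, B', v :: v :: (D.diff B' ++ D), .go b b, o ++ t⟩ ∧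
      (B' ++ D.diff B').Perm D ∧ t.Pairwise (DirLE b) ∧ t ⊆ B.diff D := by
  induction hn : B.length generalizing B o with
  | zero =>
    rw [List.length_eq_zero_iff] at hn
    subst hn
    refine ⟨[], [], reaches_next (by simp) ?_, by simp, by simp, by simp⟩
    simp [nextAction, flushAction, least_eq_none_iff.2, Action.apply]
  | succ n ih =>
    rcases hx : least b (B.diff D) with _ | x
    · have hd := least_eq_none_iff.1 hx
      refine ⟨B, [], reaches_next (by simp) ?_, ?_, by simp, by simp⟩
      · simp [nextAction, flushAction, hx, Action.apply]
      · refine List.subperm_append_diff_self_of_count_le fun z _ => ?_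
        have := List.count_diff z B D
        rw [hd, List.count_nil] at this
        omega
    · obtain ⟨hxm, hxmin⟩ := least_eq_some_iff.1 hx
      have hxB : x ∈ B := (List.diff_sublist B D).subset hxm
      obtain ⟨B', t, hr, hp, hs, hsub⟩ := ih (B := B.erase x) (o := o ++ [x])
        (by rw [List.length_erase_of_mem hxB]; omega)
      have hsub' : t ⊆ B.diff D := by
        rw [← List.diff_erase] at hsub
        exact fun z hz => List.mem_of_mem_erase (hsub hz)
      refine ⟨B', x :: t, OnlineAlgorithm.Reaches.trans (reaches_next (by simp) ?_)
        (by simpa using hr), hp, List.pairwise_cons.2 ⟨fun z hz => hxmin z (hsub' hz), hs⟩, ?_⟩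
      · simp [nextAction, flushAction, hx, Action.apply, hxB]
      · intro z hz
        rcases List.mem_cons.1 hz with rfl | hz
        · exact hxm
        · exact hsub' hz

/-- The run that is being written ends first. -/
theorem reaches_of_dead_left {a b : Bool} {w v y : α} {inp B G D o : List α}
    (hD : D.length = B.length + G.length) (hx : next a w (B ++ G) = none)
    (hy : next b v D = some y) :
    ∃ B' t, (coinAlgorithm α M).Reaches (⟨inp, B, w :: v :: (G ++ D), .go a b, o⟩ : Conf α)
        ⟨inp, B', v :: v :: (D.diff B' ++ D), .go b b, o ++ t⟩ ∧
      (B' ++ D.diff B').Perm D ∧ t.Pairwise (DirLE b) ∧ t ⊆ B.diff D := by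
  obtain ⟨B', t, h, h'⟩ := reaches_flush (M := M) (b := b) (v := v) (inp := inp) (B := B) (D := D)
    (o := o)
  refine ⟨B', t, OnlineAlgorithm.Reaches.trans (reaches_next (by simp) ?_) h, h'⟩
  simp only [nextAction_go hD, goAction, hx, hy]
  rfl

/-- Two runs of the same length are carried out in parallel. -/
theorem reaches_of_steps {a b : Bool} {w w' v v' : α} {inp inp' inp'' U U' V V' r s : List α}
    (hU : Steps a w U inp r w' U' inp') (hV : Steps b v V inp s v' V' inp'')
    (hrs : r.length = s.length) {B G D : List α} (hBG : (B ++ G).Perm U) (hDV : D.Perm V)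
    (hD : D.length = B.length + G.length) (o : List α) :
    ∃ B' G' D' t, (coinAlgorithm α M).Reaches (⟨inp, B, w :: v :: (G ++ D), .go a b, o⟩ : Conf α)
        ⟨inp', B', w' :: v' :: (G' ++ D'), .go a b, o ++ t⟩ ∧ t.Sublist r ∧
      (B' ++ G').Perm U' ∧ D'.Perm V' ∧ D'.length = B'.length + G'.length := by
  induction hU generalizing v V s B G D o with
  | nil =>
    obtain rfl := List.length_eq_zero_iff.1 hrs.symm
    cases hV
    exact ⟨B, G, D, [], by simpa using OnlineAlgorithm.Reaches.refl _, by simp, hBG, hDV, hD⟩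
  | @cons w x w' U inp r U' inp' hx _ ih =>
    cases hV with
    | nil => simp at hrs
    | @cons _ y _ _ _ s _ _ hy hV =>
      rw [← next_congr hBG] at hx
      rw [← next_congr hDV] at hy
      obtain ⟨G', hG', hr⟩ := reaches_tick (M := M) (inp := inp) (o := o) hD hx hy
      have hxm := (next_eq_some_iff.1 hx).1
      have hym := (next_eq_some_iff.1 hy).1
      have hlen := hG'.length_eq
      rw [List.length_erase_of_mem hxm, List.length_append, List.length_append] at hlen
      have hpos := List.length_pos_of_mem hxm
      rw [List.length_append] at hpos
      obtain ⟨B₁, G₁, D₁, t, hr₁, ht, h₁, h₂, h₃⟩ := ih hV (by simpa using hrs)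
        (B := B.erase x ++ inp.take 1) (G := G') (D := D.erase y ++ inp.take 1)
        (by
          refine List.Perm.trans ?_ ((hG'.trans (hBG.erase x)).append_right _)
          rw [List.append_assoc, List.append_assoc]
          exact List.perm_append_comm.append_left _)
        ((hDV.erase y).append_right _)
        (by
          rw [List.length_append, List.length_append, List.length_erase_of_mem hym]
          omega)
        (o ++ (if x ∈ B then [x] else []))
      refine ⟨B₁, G₁, D₁, (if x ∈ B then [x] else []) ++ t, ?_, ?_, h₁, h₂, h₃⟩
      · rw [← List.append_assoc]
        exact OnlineAlgorithm.Reaches.trans hr hr₁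
      · split
        · simpa using ht
        · exact (List.nil_append t).symm ▸ ht.cons x

/-- The rest of a maximal run is carried out up to the next decision point. -/
theorem reaches_fill {b : Bool} {w w' : α} {inp inp' V V' r : List α}
    (hV : Steps b w V inp r w' V' inp') (hn : next b w' V' = none) {B G D : List α}
    (hBG : (B ++ G).Perm V) (hDV : D.Perm V) (o : List α) :
    ∃ B' G' t, (coinAlgorithm α M).Reaches (⟨inp, B, w :: w :: (G ++ D), .go b b, o⟩ : Conf α)
        ⟨inp', B', G', .fill, o ++ t⟩ ∧ t.Sublist r ∧ (B' ++ G').Perm V' := by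
  have hD := (hDV.trans hBG.symm).length_eq
  rw [List.length_append] at hD
  obtain ⟨B', G', D', t, hr, ht, h₁, h₂, h₃⟩ := reaches_of_steps hV hV rfl hBG hDV hD o
  refine ⟨B', G', t, OnlineAlgorithm.Reaches.trans hr (reaches_of_dead h₃ ?_ ?_), ht, h₁⟩
  · rwa [next_congr h₁]
  · rwa [next_congr h₂]

end coinAlgorithm

end Algorithm

section Analysis

variable {α : Type*} [LinearOrder α]

namespace coinAlgorithm

variable {M : ℕ}

/-! ### Memory -/

/-- The contents of the memory in the configurations that occur.  The elements `w` and `v` are the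
last ones of the two runs, `G` is the part of the virtual buffer that is missing in the buffer, and
`D` is the virtual buffer of the simulated run. -/
inductive Valid (M : ℕ) : Conf α → Prop
  | fill {inp B G o : List α} : B.length + G.length ≤ M → Valid M ⟨inp, B, G, .fill, o⟩
  | flip {inp B G o : List α} : B.length + G.length ≤ M → Valid M ⟨inp, B, G, .flip, o⟩
  | go {inp B G D o : List α} {w v : α} {a b : Bool} :
      D.length = B.length + G.length → D.length ≤ M →
      Valid M ⟨inp, B, w :: v :: (G ++ D), .go a b, o⟩
  | write {inp B G D o : List α} {w v : α} {a b : Bool} :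
      D.length = (B.erase w).length + G.length → D.length + 1 ≤ M →
      Valid M ⟨inp, B, w :: v :: (G ++ D), .write a b, o⟩
  | read {inp B G D o : List α} {w v : α} {a b : Bool} :
      D.length = B.length + G.length → D.length + 1 ≤ M →
      Valid M ⟨inp, B, w :: v :: (G ++ D), .read a b, o⟩
  | copy {inp B G D o : List α} {w v z : α} {a b : Bool} :
      D.length = B.length + G.length → D.length + 1 ≤ M →
      Valid M ⟨inp, B ++ [z], w :: v :: (G ++ D), .copy a b, o⟩
  | flush {inp B D o : List α} {v : α} {b : Bool} :
      B.length ≤ M → D.length ≤ M → Valid M ⟨inp, B, v :: D, .flush b, o⟩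

theorem Valid.space_le {c : Conf α} (h : Valid M c) :
    c.buf.length ≤ M ∧ c.buf.length + c.scratch.length ≤ M + M + 3 := by
  cases h <;> simp only [List.length_cons, List.length_append, List.length_nil]
  case write B G D _ w v _ _ h₁ h₂ =>
    have := List.length_erase_add_one (a := w) (l := B)
    by_cases hw : w ∈ B
    · have := this hw; omega
    · rw [List.erase_of_not_mem hw] at h₁; omega
  all_goals omega

theorem Valid.start {c : Conf α} (h : Valid M c) (hc : c.state = .flip) (g : Bool) :
    Valid M ((startAction g c.buf c.scratch).apply c) := by
  cases h <;> cases hc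
  next inp B G o h =>
  simp only [startAction]
  split
  · exact .go (by simp) (by simpa using h)
  · exact .flip (by simp; omega)

theorem Valid.next {c : Conf α} (h : Valid M c) :
    Valid M ((nextAction M c.state c.buf c.scratch).apply c) := by
  cases h with
  | @fill inp B G o h =>
    by_cases hlt : B.length + G.length < M
    · cases inp with
      | nil => simpa [nextAction, hlt, Action.apply] using Valid.flip h
      | cons z inp =>
        simp only [nextAction, hlt, Action.apply, if_true]
        exact .fill (by simp; omega)
    · simpa [nextAction, hlt, Action.apply] using Valid.flip h
  | @flip inp B G o h =>
    exact .fill (by simp; omega)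
  | @go inp B G D o w v a b hD hM =>
    simp only [nextAction_go hD, goAction]
    split
    · next x y hx hy =>
      have hxm := (next_eq_some_iff.1 hx).1
      have hym := (next_eq_some_iff.1 hy).1
      have hpos := List.length_pos_of_mem hym
      refine .write ?_ ?_
      · rw [List.length_erase_of_mem hym]
        by_cases hxB : x ∈ B
        · have := List.length_pos_of_mem hxB
          rw [if_pos hxB, List.length_erase_of_mem hxB]; omega
        · have hxG : x ∈ G := (List.mem_append.1 hxm).resolve_left hxB
          have := List.length_pos_of_mem hxG
          rw [if_neg hxB, List.erase_of_not_mem hxB, List.length_erase_of_mem hxG]; omega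
      · rw [List.length_erase_of_mem hym]; omega
    · exact .go (by simp) (by simp; omega)
    · exact .flush (show B.length ≤ M by omega) hM
    · exact .fill (show B.length + G.length ≤ M by omega)
  | @write inp B G D o w v a b hD hM =>
    simp only [nextAction, Action.apply]
    split
    · exact .read hD hM
    · next h =>
      rw [List.erase_of_not_mem h] at hD
      exact .read hD hM
  | @read inp B G D o w v a b hD hM =>
    cases inp with
    | nil => exact .go hD (by omega)
    | cons z inp => exact .copy hD hM
  | @copy inp B G D o w v z a b hD hM =>
    have : (Valid M ⟨inp, B ++ [z], w :: v :: (G ++ (D ++ [z])), .go a b, o⟩ : Prop) :=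
      .go (by simp; omega) (by simpa using hM)
    simpa [nextAction, Action.apply] using this
  | @flush inp B D o v b hB hD =>
    simp only [nextAction, flushAction]
    split
    · next x hx =>
      simp only [Action.apply]
      split
      · exact .flush ((List.length_erase_le).trans hB) hD
      · exact .flush hB hD
    · next hx =>
      refine .go ?_ hD
      rw [← List.length_append]
      refine (List.subperm_append_diff_self_of_count_le fun z _ => ?_).length_eq.symm
      have : [].count z = B.count z - D.count z := least_eq_none_iff.1 hx ▸ List.count_diff z B D
      rw [List.count_nil] at this
      exact (Nat.sub_eq_zero_iff_le.1 this.symm)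

theorem usesSpace (α : Type*) [LinearOrder α] {M : ℕ} (hM : 1 ≤ M) :
    (coinAlgorithm α M).UsesSpace M M 3 := by
  constructor
  · change Nat.card Phase ≤ _
    rw [card_phase]
    calc 20 ≤ 3 ^ 3 := by norm_num
      _ ≤ (M + 2) ^ 3 := Nat.pow_le_pow_left (by omega) 3
  · intro I n c hc
    refine Valid.space_le (M := M) ?_
    induction n generalizing c with
    | zero =>
      rw [OnlineAlgorithm.run, PMF.mem_support_pure_iff] at hc
      subst hc
      exact .fill (by simp)
    | succ n ih =>
      rw [OnlineAlgorithm.run, PMF.mem_support_bind_iff] at hc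
      obtain ⟨c₀, hc₀, hc⟩ := hc
      have h₀ := ih c₀ hc₀
      by_cases hq : c₀.state = .flip
      · rw [step_flip hq, PMF.mem_support_map_iff] at hc
        obtain ⟨g, -, rfl⟩ := hc
        exact h₀.start hq g
      · rw [step_eq hq, PMF.mem_support_pure_iff] at hc
        subst hc
        exact h₀.next

/-! ### Termination -/

/-- The whole input has been written. -/
def Finished (μ : PMF (Conf α)) : Prop :=
  ∀ c ∈ μ.support, c.input = [] ∧ c.buf = []

theorem apply_startAction {g : Bool} {w v : α} {inp B G o : List α}
    (hw : least g (B ++ G) = some w) (hv : least (!g) (B ++ G) = some v) :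
    (startAction g B G).apply (⟨inp, B, G, .flip, o⟩ : Conf α) =
      ⟨inp, B, w :: v :: (G ++ (B ++ G)), .go g (!g), o⟩ := by
  simp only [startAction, hw, hv]
  rfl

theorem exists_least {b : Bool} {l : List α} (h : l ≠ []) : ∃ w, least b l = some w :=
  Option.ne_none_iff_exists'.1 (mt least_eq_none_iff.1 h)

theorem next_ne_none_of_least {b : Bool} {w : α} {l : List α} (h : least b l = some w) :
    next b w l ≠ none := by
  intro hn
  exact next_eq_none_iff.1 hn w (least_eq_some_iff.1 h).1 (DirLE.refl b w)

theorem reaches_flip {inp B G o : List α} (h : M ≤ B.length + G.length ∨ inp = []) :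
    (coinAlgorithm α M).Reaches (⟨inp, B, G, .fill, o⟩ : Conf α) ⟨inp, B, G, .flip, o⟩ := by
  refine reaches_next (by simp) ?_
  by_cases hlt : B.length + G.length < M
  · obtain rfl := h.resolve_left (by omega)
    simp only [nextAction, hlt, Action.apply, if_true]
  · simp only [nextAction, hlt, Action.apply, if_false]

theorem reaches_fill_of_lt {z : α} {inp B G o : List α} (h : B.length + G.length < M) :
    (coinAlgorithm α M).Reaches (⟨z :: inp, B, G, .fill, o⟩ : Conf α)
      ⟨inp, B ++ [z], G, .fill, o⟩ :=
  reaches_next (by simp) (by simp only [nextAction, h, Action.apply, if_true])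

/-- It suffices to consider times at which both runs can be continued. -/
theorem eventually_finished_go {n : ℕ}
    (hfill : ∀ inp B G o : List α, 2 * inp.length + B.length + G.length < n →
      (coinAlgorithm α M).Eventually Finished (⟨inp, B, G, .fill, o⟩ : Conf α))
    (hlive : ∀ (a b : Bool) (w v : α) (inp B G D o : List α), D.length = B.length + G.length →
      2 * inp.length + D.length < n → next a w (B ++ G) ≠ none → next b v D ≠ none →
      (coinAlgorithm α M).Eventually Finished
        (⟨inp, B, w :: v :: (G ++ D), .go a b, o⟩ : Conf α))
    {a b : Bool} {w v : α} {inp B G D o : List α} (hD : D.length = B.length + G.length)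
    (hn : 2 * inp.length + D.length < n) :
    (coinAlgorithm α M).Eventually Finished
      (⟨inp, B, w :: v :: (G ++ D), .go a b, o⟩ : Conf α) := by
  rcases hx : next a w (B ++ G) with _ | x <;> rcases hy : next b v D with _ | y
  · exact (reaches_of_dead hD hx hy).eventually (hfill _ _ _ _ (by omega))
  · obtain ⟨B', t, hr, hp, -, -⟩ := reaches_of_dead_left (M := M) (inp := inp) (o := o) hD hx hy
    refine hr.eventually (hlive _ _ _ _ _ _ _ _ _ ?_ hn ?_ ?_)
    · rw [← List.length_append, hp.length_eq]
    · rw [next_congr hp, hy]; simp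
    · rw [hy]; simp
  · refine (reaches_of_dead_right hD hx hy).eventually (hlive _ _ _ _ _ _ _ _ _ ?_ ?_ ?_ ?_)
    · rw [List.length_append]
    · rw [List.length_append]; omega
    · rw [hx]; simp
    · rw [hx]; simp
  · exact hlive _ _ _ _ _ _ _ _ _ hD hn (by simp [hx]) (by simp [hy])

/-- The size of the virtual buffer plus twice the number of unread elements decreases whenever an
element of the virtual run is processed, and whenever an element is read at a decision point. -/
theorem eventually_finished_of_lt (hM : 1 ≤ M) (n : ℕ) :
    (∀ inp B G o : List α, 2 * inp.length + B.length + G.length < n →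
      (coinAlgorithm α M).Eventually Finished (⟨inp, B, G, .fill, o⟩ : Conf α)) ∧
    (∀ (a b : Bool) (w v : α) (inp B G D o : List α), D.length = B.length + G.length →
      2 * inp.length + D.length < n → next a w (B ++ G) ≠ none → next b v D ≠ none →
      (coinAlgorithm α M).Eventually Finished
        (⟨inp, B, w :: v :: (G ++ D), .go a b, o⟩ : Conf α)) := by
  induction n with
  | zero =>
    exact ⟨fun _ _ _ _ h => absurd h (by omega),
      fun _ _ _ _ _ _ _ _ _ _ h => absurd h (by omega)⟩
  | succ n ih =>
    obtain ⟨ihfill, ihlive⟩ := ih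
    have hlive : ∀ (a b : Bool) (w v : α) (inp B G D o : List α), D.length = B.length + G.length →
        2 * inp.length + D.length < n + 1 → next a w (B ++ G) ≠ none → next b v D ≠ none →
        (coinAlgorithm α M).Eventually Finished
          (⟨inp, B, w :: v :: (G ++ D), .go a b, o⟩ : Conf α) := by
      intro a b w v inp B G D o hD hn hx hy
      obtain ⟨x, hx⟩ := Option.ne_none_iff_exists'.1 hx
      obtain ⟨y, hy⟩ := Option.ne_none_iff_exists'.1 hy
      obtain ⟨G', hp, hr⟩ := reaches_tick (M := M) (inp := inp) (o := o) hD hx hy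
      have hxm := (next_eq_some_iff.1 hx).1
      have hym := (next_eq_some_iff.1 hy).1
      have hlen := hp.length_eq
      have hpos := List.length_pos_of_mem hym
      rw [List.length_erase_of_mem hxm, List.length_append, List.length_append] at hlen
      refine hr.eventually (eventually_finished_go ihfill ihlive ?_ ?_)
      · simp only [List.length_append, List.length_erase_of_mem hym]; omega
      · simp only [List.length_append, List.length_erase_of_mem hym, List.length_drop,
          List.length_take]
        omega
    refine ⟨fun inp B G o hn => ?_, hlive⟩
    by_cases hfull : M ≤ B.length + G.length ∨ inp = []
    · refine (reaches_flip hfull).eventually ?_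
      by_cases hV : B ++ G = []
      · obtain ⟨rfl, rfl⟩ := List.append_eq_nil_iff.1 hV
        obtain rfl := hfull.resolve_left (by simp; omega)
        refine OnlineAlgorithm.eventually_of_step_eq (step_halt rfl rfl rfl) fun c hc => ?_
        rw [PMF.mem_support_pure_iff] at hc
        subst hc
        exact ⟨rfl, rfl⟩
      · refine OnlineAlgorithm.Eventually.of_coin (Q' := fun _ => Finished) (step_flip rfl)
          (fun g => ?_) ?_
        · obtain ⟨w, hw⟩ := exists_least (b := g) hV
          obtain ⟨v, hv⟩ := exists_least (b := !g) hV
          rw [apply_startAction hw hv]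
          refine hlive _ _ _ _ _ _ _ _ _ (by simp) ?_ (next_ne_none_of_least hw)
            (next_ne_none_of_least hv)
          rw [List.length_append]; omega
        · intro p hp c hc
          obtain ⟨g, -, hg⟩ := (PMF.mem_support_bind_iff _ _ _).1 hc
          exact hp g c hg
    · obtain ⟨h₁, h₂⟩ := not_or.1 hfull
      obtain ⟨z, inp, rfl⟩ := List.exists_cons_of_ne_nil h₂
      refine (reaches_fill_of_lt (by omega)).eventually (ihfill _ _ _ _ ?_)
      simp only [List.length_append, List.length_cons, List.length_nil] at hn ⊢
      omega

theorem eventually_finished (hM : 1 ≤ M) (c : Conf α) (hc : c.state = .fill) :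
    (coinAlgorithm α M).Eventually Finished c := by
  obtain ⟨inp, B, G, q, o⟩ := c
  cases hc
  exact (eventually_finished_of_lt hM _).1 inp B G o (Nat.lt_succ_self _)

/-! ### One run of the optimal algorithm -/

/-- If the long direction `b` has been chosen, then one run is written up to the next decision
point. -/
theorem reaches_of_right_choice {b : Bool} {w v w' v' : α} {inp inp' inp'' V V' D' r s : List α}
    (hr : Steps b w V inp r w' V' inp') (hrn : next b w' V' = none)
    (hs : Steps (!b) v V inp s v' D' inp'') (hsn : next (!b) v' D' = none)
    (hlt : s.length < r.length) {B G : List α} (hBG : (B ++ G).Perm V) (o : List α) :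
    ∃ B' G' t,
      (coinAlgorithm α M).Reaches
        (⟨inp, B, w :: v :: (G ++ (B ++ G)), .go b (!b), o⟩ : Conf α)
        ⟨inp', B', G', .fill, o ++ t⟩ ∧
      (B' ++ G').Perm V' ∧ IsRun t := by
  have hrs := (List.pairwise_cons.1 hr.pairwise).2
  obtain ⟨r₁, r₂, rfl, hl⟩ : ∃ r₁ r₂, r = r₁ ++ r₂ ∧ r₁.length = s.length :=
    ⟨r.take s.length, r.drop s.length, (List.take_append_drop _ _).symm, by
      rw [List.length_take]; omega⟩
  obtain ⟨w₁, V₁, inp₁, h₁, h₂⟩ := hr.split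
  obtain ⟨B₁, G₁, D₁, t₁, hreach, ht₁, hp, hp', hlen⟩ :=
    reaches_of_steps (M := M) h₁ hs hl hBG hBG (by simp) o
  obtain ⟨x, hx⟩ : ∃ x, next b w₁ V₁ = some x := by
    cases h₂ with
    | nil => simp at hlt; omega
    | cons hx _ => exact ⟨_, hx⟩
  have hdead := reaches_of_dead_right (M := M) (inp := inp₁) (o := o ++ t₁) (x := x) (a := b)
    (w := w₁) (b := !b) (v := v') hlen (by rwa [next_congr hp]) (by rwa [next_congr hp'])
  obtain ⟨B', G', t₂, hreach', ht₂, hp''⟩ := reaches_fill (M := M) h₂ hrn hp hp (o ++ t₁)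
  refine ⟨B', G', t₁ ++ t₂, ?_, hp'', isRun_of_pairwise_dirLE (hrs.sublist (ht₁.append ht₂))⟩
  rw [← List.append_assoc o]
  exact (hreach.trans hdead).trans hreach'

/-- If the short direction has been chosen, then a second run leads to the same decision point. -/
theorem reaches_of_wrong_choice {b : Bool} {w v w' v' : α} {inp inp' inp'' V V' U' r s : List α}
    (hnd : (V ++ inp).Nodup)
    (hr : Steps b w V inp r w' V' inp') (hrn : next b w' V' = none)
    (hs : Steps (!b) v V inp s v' U' inp'') (hsn : next (!b) v' U' = none)
    (hlt : s.length < r.length) {B G : List α} (hBG : (B ++ G).Perm V) (o : List α) :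
    ∃ B' G' t t',
      (coinAlgorithm α M).Reaches
        (⟨inp, B, v :: w :: (G ++ (B ++ G)), .go (!b) b, o⟩ : Conf α)
        ⟨inp', B', G', .fill, o ++ (t ++ t')⟩ ∧
      (B' ++ G').Perm V' ∧ IsRun t ∧ IsRun t' := by
  have hrp := (List.pairwise_cons.1 hr.pairwise).2
  have hsp := (List.pairwise_cons.1 hs.pairwise).2
  obtain ⟨r₁, r₂, rfl, hl⟩ : ∃ r₁ r₂, r = r₁ ++ r₂ ∧ r₁.length = s.length :=
    ⟨r.take s.length, r.drop s.length, (List.take_append_drop _ _).symm, by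
      rw [List.length_take]; omega⟩
  obtain ⟨w₁, V₁, inp₁, h₁, h₂⟩ := hr.split
  obtain rfl : inp'' = inp₁ := by rw [hs.input_eq, h₁.input_eq, hl]
  obtain ⟨B₁, G₁, D₁, t₁, hreach, ht₁, hp, hp', hlen⟩ :=
    reaches_of_steps (M := M) hs h₁ hl.symm hBG hBG (by simp) o
  obtain ⟨y, hy⟩ : ∃ y, next b w₁ V₁ = some y := by
    cases h₂ with
    | nil => simp at hlt; omega
    | cons hy _ => exact ⟨_, hy⟩
  obtain ⟨B₂, t₂, hreach₂, hp₂, ht₂, hsub⟩ := reaches_of_dead_left (M := M) (inp := inp'')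
    (o := o ++ t₁) (a := !b) (w := v') (b := b) (v := w₁) (y := y) hlen (by rwa [next_congr hp])
    (by rwa [next_congr hp'])
  obtain ⟨B', G', t₃, hreach₃, ht₃, hp₃⟩ :=
    reaches_fill (M := M) h₂ hrn (hp₂.trans hp') hp' (o ++ t₁ ++ t₂)
  refine ⟨B', G', t₁, t₂ ++ t₃, ?_, hp₃, isRun_of_pairwise_dirLE (hsp.sublist ht₁),
    isRun_of_pairwise_dirLE (b := b) (List.pairwise_append.2 ⟨ht₂, ?_, ?_⟩)⟩
  · rw [← List.append_assoc o, ← List.append_assoc (o ++ t₁)]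
    exact (hreach.trans hreach₂).trans hreach₃
  · exact ((List.pairwise_append.1 hrp).2.1).sublist ht₃
  · -- an element that is in the buffer, but not in the virtual buffer of the longer run, has already
    -- been written by that run
    intro z hz z' hz'
    have hB₁ : B₁.Nodup := by
      have := (List.nodup_append.1 (hs.nodup_rest hnd)).1
      exact (List.nodup_append.1 (hp.nodup_iff.2 this)).1
    obtain ⟨hzB, hzD⟩ := hB₁.mem_sdiff_iff.1 (hsub hz)
    have hzU : z ∈ U' := hp.mem_iff.1 (List.mem_append_left _ hzB)
    have hzr : z ∈ r₁ ++ V₁ := by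
      rw [← h₁.perm.mem_iff, hl, hs.perm.mem_iff]
      exact List.mem_append_right _ hzU
    have hzr₁ : z ∈ r₁ :=
      (List.mem_append.1 hzr).resolve_right fun h => hzD (hp'.mem_iff.2 h)
    exact (h₁.dirLE_last z (List.mem_cons_of_mem _ hzr₁)).trans
      ((List.pairwise_cons.1 h₂.pairwise).1 z' (ht₃.subset hz'))

/-! ### The number of runs -/

/-- The output has at most `m + 3 / 2 * k` runs in expectation, and never more than `m + 2 * k`. -/
def RunBound (m k : ℕ) (μ : PMF (Conf α)) : Prop :=
  ∑' c, μ c * (numRuns c.out : ℝ≥0∞) ≤ m + 3 / 2 * k ∧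
    ∀ c ∈ μ.support, numRuns c.out ≤ m + 2 * k

theorem runBound_pure {m : ℕ} {c : Conf α} (h : numRuns c.out ≤ m) :
    RunBound m 0 (PMF.pure c) := by
  constructor
  · rw [tsum_eq_single c]
    · simpa using h
    · intro c' hc'
      simp [PMF.pure_apply, hc']
  · intro c' hc'
    rw [PMF.mem_support_pure_iff] at hc'
    subst hc'
    omega

theorem runBound_bind {m k : ℕ} {b : Bool} {p : Bool → PMF (Conf α)}
    (h : RunBound (m + 1) k (p b)) (h' : RunBound (m + 2) k (p !b)) :
    RunBound m (k + 1) ((PMF.uniformOfFintype Bool).bind p) := by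
  constructor
  · have hsum : ∑' c, (PMF.uniformOfFintype Bool).bind p c * (numRuns c.out : ℝ≥0∞) =
        2⁻¹ * (∑' c, p b c * (numRuns c.out : ℝ≥0∞)) +
          2⁻¹ * (∑' c, p (!b) c * (numRuns c.out : ℝ≥0∞)) := by
      rw [← ENNReal.tsum_mul_left, ← ENNReal.tsum_mul_left, ← ENNReal.tsum_add]
      refine tsum_congr fun c => ?_
      rw [PMF.bind_apply, tsum_fintype]
      cases b <;> simp [add_mul, mul_assoc, add_comm]
    rw [hsum]
    refine (add_le_add (mul_le_mul_right h.1 _) (mul_le_mul_right h'.1 _)).trans (le_of_eq ?_)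
    have h2 : (2⁻¹ : ℝ≥0∞) * 2 = 1 := ENNReal.inv_mul_cancel (by simp) (by simp)
    rw [ENNReal.div_eq_inv_mul]
    push_cast
    calc (2⁻¹ : ℝ≥0∞) * (m + 1 + 2⁻¹ * 3 * k) + 2⁻¹ * (m + 2 + 2⁻¹ * 3 * k)
        = (2⁻¹ * 2) * m + 2⁻¹ * 3 + (2⁻¹ * 2) * (2⁻¹ * 3 * k) := by ring
      _ = m + 2⁻¹ * 3 * (k + 1) := by rw [h2]; ring
  · intro c hc
    obtain ⟨g, -, hg⟩ := (PMF.mem_support_bind_iff _ _ _).1 hc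
    by_cases hgb : g = b
    · subst hgb
      have := h.2 c hg
      omega
    · obtain rfl : g = !b := by cases g <;> cases b <;> simp_all
      have := h'.2 c hg
      omega

/-- From a decision point of the optimal algorithm, each of its runs costs one or two runs, depending
on the coin. -/
theorem eventually_runBound (hM : 1 ≤ M) {V inp : List α} {rs : List (List α)}
    (hrs : ProperRuns V inp rs) (hlong : ∀ r ∈ rs, 3 * M ≤ r.length) (hnd : (V ++ inp).Nodup)
    (hV : V.length = M ∨ V.length ≤ M ∧ inp = []) {B G : List α} (hBG : (B ++ G).Perm V)
    {parts : List (List α)} (hparts : ∀ p ∈ parts, IsRun p) :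
    (coinAlgorithm α M).Eventually (RunBound parts.length rs.length)
      (⟨inp, B, G, .fill, parts.flatten⟩ : Conf α) := by
  induction rs generalizing V inp B G parts with
  | nil =>
    cases hrs
    obtain ⟨rfl, rfl⟩ := List.append_eq_nil_iff.1 hBG.eq_nil
    exact (reaches_flip (Or.inr rfl)).eventually (OnlineAlgorithm.eventually_of_step_eq
      (step_halt rfl rfl rfl) (runBound_pure (numRuns_flatten_le hparts)))
  | cons r rs ih =>
    obtain ⟨b, w, w', V', inp', hw, hr, hrn, hrs'⟩ := hrs.exists_steps
    have hrl := hlong r (by simp)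
    have hVM : V.length = M := by
      refine hV.resolve_right fun ⟨hV, h⟩ => ?_
      have := hr.perm.length_eq
      simp only [h, List.take_nil, List.append_nil, List.length_append] at this
      omega
    have hBGl : B.length + G.length = M := by
      rw [← List.length_append, hBG.length_eq, hVM]
    have hne : B ++ G ≠ [] := by
      intro h; rw [List.append_eq_nil_iff] at h; obtain ⟨rfl, rfl⟩ := h; simp at hBGl; omega
    obtain ⟨v, hv⟩ := exists_least (b := !b) hne
    obtain ⟨s, v', D', inp'', hs, hsn, hlt⟩ :=
      exists_short_steps hM (v := v) hVM.le hnd hr hrl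
    have hw' : least b (B ++ G) = some w := by
      rw [least_eq_some_iff] at hw ⊢
      simpa only [hBG.mem_iff] using hw
    have ih' {B' G' : List α} (hp : (B' ++ G').Perm V') {parts : List (List α)}
        (hparts : ∀ p ∈ parts, IsRun p) :
        (coinAlgorithm α M).Eventually (RunBound parts.length rs.length)
          (⟨inp', B', G', .fill, parts.flatten⟩ : Conf α) :=
      ih hrs' (fun r hr => hlong r (by simp [hr])) (hr.nodup_rest hnd)
        (hr.full_rest (Or.inl hVM)) hp hparts
    refine (reaches_flip (Or.inl hBGl.ge)).eventually ?_
    refine OnlineAlgorithm.Eventually.of_coin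
      (Q' := fun g => if g = b then RunBound (parts.length + 1) rs.length
        else RunBound (parts.length + 2) rs.length) (step_flip rfl) (fun g => ?_) ?_
    · by_cases hg : g = b
      · subst hg
        rw [if_pos rfl, apply_startAction hw' hv]
        obtain ⟨B', G', t, hreach, hp, ht⟩ :=
          reaches_of_right_choice (M := M) hr hrn hs hsn hlt hBG parts.flatten
        refine hreach.eventually ?_
        have := ih' hp (parts := parts ++ [t]) (by
          intro p hp
          rcases List.mem_append.1 hp with hp | hp
          · exact hparts p hp
          · rw [List.mem_singleton] at hp; exact hp ▸ ht)
        simpa using this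
      · obtain rfl : g = !b := by cases g <;> cases b <;> simp_all
        rw [if_neg hg, apply_startAction hv (by rwa [Bool.not_not])]
        obtain ⟨B', G', t, t', hreach, hp, ht, ht'⟩ :=
          reaches_of_wrong_choice (M := M) hnd hr hrn hs hsn hlt hBG parts.flatten
        rw [Bool.not_not]
        refine hreach.eventually ?_
        have := ih' hp (parts := parts ++ [t, t']) (by
          intro p hp
          rcases List.mem_append.1 hp with hp | hp
          · exact hparts p hp
          · simp only [List.mem_cons, List.not_mem_nil, or_false] at hp
            rcases hp with rfl | rfl
            exacts [ht, ht'])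
        simpa using this
    · intro p hp
      refine runBound_bind (b := b) ?_ ?_
      · simpa using hp b
      · simpa using hp (!b)

/-- The input is read up to the first decision point. -/
theorem reaches_first {inp B : List α} (h : B.length ≤ M) :
    (coinAlgorithm α M).Reaches (⟨inp, B, [], .fill, []⟩ : Conf α)
      ⟨inp.drop (M - B.length), B ++ inp.take (M - B.length), [], .fill, []⟩ := by
  induction inp generalizing B with
  | nil => simpa using OnlineAlgorithm.Reaches.refl _
  | cons z inp ih =>
    by_cases hlt : B.length < M
    · obtain ⟨k, hk⟩ := Nat.exists_eq_succ_of_ne_zero (by omega : M - B.length ≠ 0)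
      have := ih (B := B ++ [z]) (by simp; omega)
      have hk' : M - (B ++ [z]).length = k := by simp; omega
      rw [hk'] at this
      rw [hk]
      exact (reaches_fill_of_lt (by simpa using hlt)).trans (by simpa using this)
    · have : M - B.length = 0 := by omega
      simpa [this] using OnlineAlgorithm.Reaches.refl _

theorem eventually_runBound_of_nearlySorted (hM : 1 ≤ M) {I : List α} (hnd : I.Nodup)
    (hI : NearlySorted 3 M I) :
    (coinAlgorithm α M).Eventually (RunBound 0 (opt M I)) (⟨I, [], [], .fill, []⟩ : Conf α) := by
  obtain ⟨rs, hrs, hopt, hlong⟩ := hI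
  have hnd' : (I.take M ++ I.drop M).Nodup := by rwa [List.take_append_drop]
  have hle : rs.length ≤ opt M I := by
    rw [← hopt]
    exact hrs.length_le_numRuns hnd' fun r hr => by have := hlong r hr; omega
  have hV : (I.take M).length = M ∨ (I.take M).length ≤ M ∧ I.drop M = [] := by
    rw [List.length_take, List.drop_eq_nil_iff]; omega
  have h := (reaches_first (M := M) (inp := I) (B := []) (by simp)).eventually
    (Q := RunBound 0 rs.length)
    (by simpa using eventually_runBound hM hrs hlong hnd' hV (B := I.take M) (G := [])
          (by simp) (parts := []) (by simp))
  obtain ⟨T, hT⟩ := h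
  refine ⟨T, fun n hn => ⟨(hT n hn).1.trans (by gcongr), fun c hc => ?_⟩⟩
  have := (hT n hn).2 c hc
  omega

end coinAlgorithm

end Analysis

end RunGen

theorem mainTheorem9 :
    ∃ w : ℕ, ∀ (α : Type*) [LinearOrder α] (M : ℕ), 1 ≤ M →
      ∃ A : RunGen.OnlineAlgorithm α,
        A.UsesSpace M M w ∧
        ∀ I : List α, ∃ T : ℕ, A.FinishesBy I T ∧
          (I.Nodup → RunGen.NearlySorted 3 M I →
            A.expectedRuns I T ≤ (3 / 2 : ℝ≥0∞) * (RunGen.opt M I : ℝ≥0∞) ∧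
            ∀ c ∈ (A.run I T).support, RunGen.numRuns c.out ≤ 2 * RunGen.opt M I) := by
  refine ⟨3, fun α _ M hM => ⟨RunGen.coinAlgorithm α M, RunGen.coinAlgorithm.usesSpace α hM,
    fun I => ?_⟩⟩
  obtain ⟨T₁, hT₁⟩ := RunGen.coinAlgorithm.eventually_finished hM
    (⟨I, [], [], .fill, []⟩ : RunGen.coinAlgorithm.Conf α) rfl
  by_cases hI : I.Nodup ∧ RunGen.NearlySorted 3 M I
  · obtain ⟨T₂, hT₂⟩ := RunGen.coinAlgorithm.eventually_runBound_of_nearlySorted hM hI.1 hI.2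
    obtain ⟨hE, hS⟩ := hT₂ (max T₁ T₂) (le_max_right _ _)
    refine ⟨max T₁ T₂, ?_, fun _ _ => ⟨?_, ?_⟩⟩
    · rw [RunGen.OnlineAlgorithm.FinishesBy, RunGen.OnlineAlgorithm.run_eq_lawFrom]
      exact hT₁ _ (le_max_left _ _)
    · rw [RunGen.OnlineAlgorithm.expectedRuns, RunGen.OnlineAlgorithm.run_eq_lawFrom]
      simpa using hE
    · rw [RunGen.OnlineAlgorithm.run_eq_lawFrom]
      simpa using hS
  · refine ⟨T₁, ?_, fun h₁ h₂ => absurd ⟨h₁, h₂⟩ hI⟩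
    rw [RunGen.OnlineAlgorithm.FinishesBy, RunGen.OnlineAlgorithm.run_eq_lawFrom]
    exact hT₁ _ le_rfl
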